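/- Let $0<\alpha<1$. Identify $X=\{0,1\}^{\mathbb N}$ with the set of infinite paths in Pascal's graph that start at the root $(0,0)$: from the vertex $(n,k)$, $0\le k\le n$, the label $0$ leads to $(n+1,k)$ and the label $1$ leads to $(n+1,k+1)$. For $x\in X$ let $k_j(x)$ be the number of $1$'s among the first $j$ labels of $x$, so that $x$ passes through $(j,k_j(x))$ at level $j$, and let $d_j(x)=\binom{j}{k_j(x)}$, $j=0,1,2,\dots$. Let $\mu_\alpha$ be the Bernoulli measure on $X$ under which the labels are independent, each equal to $1$ with probability $\alpha$ and to $0$ with probability $1-\alpha$. A sequence $(u_j)_{j\ge 0}$ in the unit circle $S^1$ is called uniformly distributed if, for all real $a\le b\le a+1$, $$\lim_{N\to\infty}\frac1N\,\#\bigl\{0\le j<N:\ u_j\in\{e^{2\pi i t}: a\le t<b\}\bigr\}=b-a .$$ **Theorem 5.4.** There exist a dense $G_\delta$ subset $\Lambda$ of $[0,1)$ and a measurable set $Y\subset X$ with $\mu_\alpha(Y)=1$ such that, for every $\theta\in\Lambda$ and every $x\in Y$, the set $\{e^{2\pi i d_j(x)\theta}: j\in\mathbb N\}$ is dense in $S^1$,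 but the sequence $(e^{2\pi i d_j(x)\theta})_{j\ge0}$ is not uniformly distributed in $S^1$. -/

import Mathlib

open Filter Topology MeasureTheory ProbabilityTheory

noncomputable section

/-- An infinite path from the root of the Pascal graph, coded by its edge labels: at a vertex
`(n, k)` the label `false` (that is, `0`) leads to `(n + 1, k)` and the label `true` (that is, `1`)
leads to `(n + 1, k + 1)`. -/
abbrev PascalPath : Type := ℕ → Bool

/-- The second coordinate `k_n(x)` of the vertex `(n, k_n(x))` of the path `x` at level `n`. -/
def pathColumn (x : PascalPath) : ℕ → ℕ
  | 0 => 0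
  | n + 1 => pathColumn x n + if x n = true then 1 else 0

/-- The binomial coefficient `d_n(x) = C(n, k_n(x))` at level `n` of the path `x`. -/
def pathBinom (x : PascalPath) (n : ℕ) : ℕ :=
  Nat.choose n (pathColumn x n)

/-- The Bernoulli measure `μ_α` on the space of paths: the edge labels are independent, each equal
to `1` with probability `α` and to `0` with probability `1 - α`. -/
def pascalBernoulli (α : unitInterval) : Measure PascalPath :=
  Measure.infinitePi fun _ : ℕ => bernoulliMeasure true false α

/-- The half-open arc `{e^{2πit} : a ≤ t < b}` of the unit circle. -/
def circleArc (a b : ℝ) : Set Circle :=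
  (fun t : ℝ => Circle.exp (2 * Real.pi * t)) '' Set.Ico a b

open Classical in
/-- A sequence `u_0, u_1, …` in the unit circle is uniformly distributed: for every arc, the
proportion of the first `N` terms that lie in the arc converges to the normalized length of the
arc. -/
def CircleUniformlyDistributed (u : ℕ → Circle) : Prop :=
  ∀ a b : ℝ, a ≤ b → b ≤ a + 1 →
    Tendsto (fun N : ℕ => (((Finset.range N).filter fun j => u j ∈ circleArc a b).card : ℝ) / N)
      atTop (𝓝 (b - a))

/-- The points `e^{2πi d_j(x)θ}`, `j = 0, 1, 2, …`. -/
def pathRotation (x : PascalPath) (θ : ℝ) (j : ℕ) : Circle :=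
  Circle.exp (2 * Real.pi * (pathBinom x j * θ))

end

/-! Both conclusions are countable families of conditions "some finite-time event occurs": the orbit
visits the `i`-th basic open set, and at some time not before `i` more than half of the points so
far lie in a short open arc around 1. Each event involves finitely many binomial coefficients, so it
persists under small changes of θ, uniformly in the path. A Baire argument
(`exists_dense_isGδ_prod_full_measure`) then reduces everything to showing that each condition holds
almost surely for a dense set of θ; its point is that `Y` does not depend on θ.

For visits, almost every θ works. Along almost every path the coefficients are unbounded, so the
density theorem (`ae_exists_circleExp_mul_mem`) applies path by path, and Fubini exchanges the
quantifiers.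

For clustering, take θ = p/q with q prime: whenever q divides d_j the point is exactly 1. By Lucas,
the proportion of residue pairs (n, k) modulo q^r with C(n, k) prime to q is at most (1 - 1/q²)^r.
The column is asymptotically uniform modulo q^r, by Fourier analysis on `ZMod (q ^ r)`, so the
expected proportion of indices with q ∤ d_j is small at suitable late times. Markov's inequality
then gives an almost sure majority of 1's at arbitrarily late times. -/

/-! ### Baire category combined with full measure -/

/-- Near a parameter `t` for which
almost every `x` lies in `⋃ N, F N t`, all parameters share an event of almost full measure. -/
theorem exists_isOpen_measurableSet_subset_iUnion {X T : Type*} [MeasurableSpace X]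
    {μ : Measure X} [IsProbabilityMeasure μ] [TopologicalSpace T] {F : ℕ → T → Set X}
    (hmeas : ∀ N t, MeasurableSet (F N t))
    (hopen : ∀ N t, ∀ᶠ s in 𝓝 t, F N t ⊆ F N s) {t : T}
    (ht : ∀ᵐ x ∂μ, ∃ N, x ∈ F N t) {ε : ENNReal} (hε : 0 < ε) :
    ∃ (V : Set T) (A : Set X), IsOpen V ∧ t ∈ V ∧ MeasurableSet A ∧ μ Aᶜ ≤ ε ∧
      ∀ s ∈ V, ∀ x ∈ A, ∃ N, x ∈ F N s := by
  have hU : Tendsto (fun n => μ (⋃ m ∈ Set.Iic n, F m t)ᶜ) atTop (𝓝 0) := by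
    have h0 : μ (⋂ n, (⋃ m ∈ Set.Iic n, F m t)ᶜ) = 0 := by
      rw [ae_iff] at ht
      refine measure_mono_null ?_ ht
      intro x hx
      simp only [Set.mem_iInter, Set.mem_compl_iff, Set.mem_iUnion, Set.mem_Iic, not_exists] at hx
      simp only [Set.mem_ofPred_eq, not_exists]
      exact fun N => hx N N le_rfl
    rw [← h0]
    refine tendsto_measure_iInter_atTop (fun n => ?_) ?_ ⟨0, measure_ne_top _ _⟩
    · exact ((MeasurableSet.biUnion (Set.to_countable _) fun m _ => hmeas m t).compl).nullMeasurableSet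
    · intro a b hab
      refine Set.compl_subset_compl.mpr (Set.biUnion_subset_biUnion_left ?_)
      exact Set.Iic_subset_Iic.mpr hab
  -- Truncating at a finite `n` costs measure at most `ε` and leaves finitely many neighbourhoods to
  -- intersect.
  obtain ⟨n, hn⟩ := (hU.eventually (ge_mem_nhds hε)).exists
  have hev : ∀ᶠ s in 𝓝 t, ∀ m ∈ Set.Iic n, F m t ⊆ F m s :=
    (eventually_all_finite (Set.finite_Iic n)).mpr fun m _ => hopen m t
  obtain ⟨V, hV, hVo, htV⟩ := eventually_nhds_iff.mp hev
  refine ⟨V, ⋃ m ∈ Set.Iic n, F m t, hVo, htV,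
    MeasurableSet.biUnion (Set.to_countable _) fun m _ => hmeas m t, hn, ?_⟩
  intro s hs x hx
  simp only [Set.mem_iUnion] at hx
  obtain ⟨m, hm, hx⟩ := hx
  exact ⟨m, hV s hs m hm hx⟩

/-- If countably many properties of a pair `(t, x)`, each a union of events that are open in `t`
uniformly in `x`, hold for almost every `x` along dense sets of parameters, then they hold
simultaneously on the product of a dense `Gδ` set and a set of full measure. -/
theorem exists_dense_isGδ_prod_full_measure {X T ι : Type*} [MeasurableSpace X]
    (μ : Measure X) [IsProbabilityMeasure μ] [TopologicalSpace T] [SecondCountableTopology T]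
    [BaireSpace T] [Nonempty T] [Countable ι] (F : ι → ℕ → T → Set X)
    (hmeas : ∀ i N t, MeasurableSet (F i N t))
    (hopen : ∀ i N t, ∀ᶠ s in 𝓝 t, F i N t ⊆ F i N s)
    (hdense : ∀ i, Dense {t | ∀ᵐ x ∂μ, ∃ N, x ∈ F i N t}) :
    ∃ (Λ : Set T) (Y : Set X), IsGδ Λ ∧ Dense Λ ∧ MeasurableSet Y ∧ μ Y = 1 ∧
      ∀ t ∈ Λ, ∀ x ∈ Y, ∀ i, ∃ N, x ∈ F i N t := by
  have hD : ∀ i, ∃ u : ℕ → T, (∀ m, ∀ᵐ x ∂μ, ∃ N, x ∈ F i N (u m)) ∧ Dense (Set.range u) := by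
    intro i
    obtain ⟨D, hDs, hDc, hDd⟩ := (hdense i).exists_countable_dense_subset
    obtain ⟨u, rfl⟩ := hDc.exists_eq_range hDd.nonempty
    exact ⟨u, fun m => hDs ⟨m, rfl⟩, hDd⟩
  choose u hu hud using hD
  -- The weights make the errors at level `s` sum over `m` to at most `2⁻ˢ`.
  obtain ⟨δ, hδ, hδs⟩ := ENNReal.exists_pos_sum_of_countable' (ε := 1) one_ne_zero ℕ
  have hε : ∀ m s : ℕ, 0 < δ m * (2 : ENNReal)⁻¹ ^ s := fun m s =>
    ENNReal.mul_pos (hδ m).ne' (pow_ne_zero _ (by simp))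
  choose V A hVo huV hAm hA hVA using fun i m s =>
    exists_isOpen_measurableSet_subset_iUnion (hmeas i) (hopen i) (hu i m) (hε m s)
  -- A point of `Y` has, for each `i`, a level `s` good for all `m` at once; a point of `Λ` lies in
  -- some `V i m s` at that same level.
  refine ⟨⋂ p : ι × ℕ, ⋃ m, V p.1 m p.2, ⋂ i, ⋃ s, ⋂ m, A i m s, ?_, ?_, ?_, ?_, ?_⟩
  · exact IsGδ.iInter_of_isOpen fun p => isOpen_iUnion fun m => hVo _ _ _
  · refine dense_iInter_of_isOpen (fun p => isOpen_iUnion fun m => hVo _ _ _) fun p => ?_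
    refine (hud p.1).mono ?_
    rintro _ ⟨m, rfl⟩
    exact Set.mem_iUnion.mpr ⟨m, huV _ _ _⟩
  · exact MeasurableSet.iInter fun i => MeasurableSet.iUnion fun s => MeasurableSet.iInter fun m =>
      hAm _ _ _
  · rw [← prob_compl_eq_zero_iff (MeasurableSet.iInter fun i => MeasurableSet.iUnion fun s =>
      MeasurableSet.iInter fun m => hAm _ _ _), Set.compl_iInter, measure_iUnion_null_iff]
    intro i
    have hle : ∀ s : ℕ, μ (⋃ s, ⋂ m, A i m s)ᶜ ≤ (2 : ENNReal)⁻¹ ^ s := by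
      intro s
      calc μ (⋃ s, ⋂ m, A i m s)ᶜ ≤ μ (⋃ m, (A i m s)ᶜ) := by
            rw [← Set.compl_iInter]
            exact measure_mono (Set.compl_subset_compl.mpr
              (Set.subset_iUnion (fun s => ⋂ m, A i m s) s))
        _ ≤ ∑' m, μ (A i m s)ᶜ := measure_iUnion_le _
        _ ≤ ∑' m, δ m * (2 : ENNReal)⁻¹ ^ s := ENNReal.tsum_le_tsum fun m => hA i m s
        _ = (∑' m, δ m) * (2 : ENNReal)⁻¹ ^ s := ENNReal.tsum_mul_right
        _ ≤ 1 * (2 : ENNReal)⁻¹ ^ s := by gcongr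
        _ = _ := one_mul _
    exact le_antisymm (ge_of_tendsto'
      (ENNReal.tendsto_pow_atTop_nhds_zero_of_lt_one (by simp)) hle) zero_le
  · intro t ht x hx i
    obtain ⟨s, hs⟩ := Set.mem_iUnion.mp (Set.mem_iInter.mp hx i)
    obtain ⟨m, hm⟩ := Set.mem_iUnion.mp (Set.mem_iInter.mp ht (i, s))
    exact hVA i m s t hm x (Set.mem_iInter.mp hs m)

/-! ### Visits to an open set for almost every angle -/

/-- Along an unbounded sequence of natural numbers `d`, the points `exp (2πi d_j θ)` visit a given
nonempty open subset of the circle for almost every `θ`. -/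
theorem ae_exists_circleExp_mul_mem {d : ℕ → ℕ} (hd : ∀ n, ∃ j, n ≤ d j) {B : Set Circle}
    (hB : IsOpen B) (hBne : B.Nonempty) :
    ∀ᵐ θ : ℝ, ∃ j, Circle.exp (2 * Real.pi * (d j * θ)) ∈ B := by
  set E : ℝ → Circle := fun t => Circle.exp (2 * Real.pi * t) with hE
  have hEc : Continuous E := by fun_prop
  have hEper : ∀ t (m : ℤ), E (t + m) = E t := by
    intro t m
    simp only [hE, mul_add, Circle.exp_add, Circle.exp_two_pi_mul_int, mul_one]
  obtain ⟨t, ht⟩ : ∃ t, E t ∈ B := by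
    obtain ⟨z, hz⟩ := hBne
    obtain ⟨s, rfl⟩ := Circle.exp_surjective z
    refine ⟨s / (2 * Real.pi), ?_⟩
    simpa [hE, mul_div_cancel₀, Real.pi_ne_zero] using hz
  obtain ⟨ε, hε, hεB⟩ := Metric.isOpen_iff.mp (hB.preimage hEc) t ht
  set S : Set ℝ := {θ | ∀ j, E (d j * θ) ∉ B} with hS
  have hSm : MeasurableSet S := by
    have : S = ⋂ j, (fun θ : ℝ => E (d j * θ)) ⁻¹' Bᶜ := by ext; simp [hS]
    rw [this]
    exact MeasurableSet.iInter fun j =>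
      ((hB.isClosed_compl).preimage (by fun_prop)).measurableSet
  suffices h0 : volume S = 0 by
    rw [ae_iff]
    simpa [hS, hE] using h0
  rw [← Measure.restrict_eq_zero, ← ae_eq_bot, ← not_neBot]
  intro hne
  -- At a density point, `S` fills balls of radius `1 / d j` in the limit; yet each such ball has a
  -- hole of fixed proportion `c`, because θ ↦ E(d_j θ) has period `1 / d j`.
  have hdens := IsUnifLocDoublingMeasure.ae_tendsto_measure_inter_div (volume : Measure ℝ) S 1
  obtain ⟨x, hx⟩ := hdens.exists
  choose j hj using fun n : ℕ => hd (n + 1)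
  have hjpos : ∀ n, (0 : ℝ) < d (j n) := fun n => by
    have := hj n
    exact_mod_cast (by omega : 0 < d (j n))
  have hδ : Tendsto (fun n => 1 / (d (j n) : ℝ)) atTop (𝓝[>] 0) := by
    rw [tendsto_nhdsWithin_iff]
    refine ⟨?_, Eventually.of_forall fun n => one_div_pos.mpr (hjpos n)⟩
    refine squeeze_zero (fun n => (one_div_pos.mpr (hjpos n)).le) (fun n => ?_)
      tendsto_one_div_add_atTop_nhds_zero_nat
    have : ((n + 1 : ℕ) : ℝ) ≤ d (j n) := by exact_mod_cast hj n
    push_cast at this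
    gcongr
  have hlim := hx (fun _ => x) (fun n => 1 / (d (j n) : ℝ)) hδ
    (Eventually.of_forall fun n => by simp)
  -- The bound 1/2 keeps the hole, whose centre is within `1 / (2D)` of `x`, inside the ball of
  -- radius `1 / D`.
  set c : ℝ := min ε (1 / 2) with hc
  have hcpos : 0 < c := lt_min hε (by norm_num)
  have hc2 : c ≤ 1 / 2 := min_le_right _ _
  have hbound : ∀ n, volume (S ∩ Metric.closedBall x (1 / (d (j n) : ℝ))) /
      volume (Metric.closedBall x (1 / (d (j n) : ℝ))) ≤ ENNReal.ofReal (1 - c) := by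
    intro n
    set D : ℝ := (d (j n) : ℝ) with hD
    have hDpos : 0 < D := hjpos n
    set m : ℤ := round (D * x - t) with hm
    have hmr : |D * x - t - m| ≤ 1 / 2 := abs_sub_round _
    set y : ℝ := (t + m) / D with hy
    have hyx : |y - x| ≤ 1 / 2 / D := by
      have : y - x = -((D * x - t - m) / D) := by rw [hy]; field_simp; ring
      rw [this, abs_neg, abs_div, abs_of_pos hDpos]
      gcongr
    have hsub : Metric.ball y (c / D) ⊆ Metric.closedBall x (1 / D) := by
      intro z hz
      rw [Metric.mem_ball, Real.dist_eq] at hz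
      rw [Metric.mem_closedBall, Real.dist_eq]
      calc |z - x| = |(z - y) + (y - x)| := by ring_nf
        _ ≤ |z - y| + |y - x| := abs_add_le _ _
        _ ≤ 1 / 2 / D + 1 / 2 / D := by
            refine add_le_add (hz.le.trans ?_) hyx
            gcongr
        _ = 1 / D := by ring
    have hdis : Disjoint S (Metric.ball y (c / D)) := by
      rw [Set.disjoint_right]
      intro z hz hzS
      apply hzS (j n)
      have : E (D * z) = E (D * z - m) := by
        have := hEper (D * z - m) m
        rwa [sub_add_cancel] at this
      rw [← hD, this]
      apply hεB
      rw [Metric.mem_ball, Real.dist_eq] at hz ⊢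
      have h1 : D * z - m - t = D * (z - y) := by rw [hy]; field_simp; ring
      rw [h1, abs_mul, abs_of_pos hDpos]
      calc D * |z - y| < D * (c / D) := by gcongr
        _ = c := by field_simp
        _ ≤ ε := min_le_left _ _
    have hvol : volume (S ∩ Metric.closedBall x (1 / D)) ≤ ENNReal.ofReal (2 * (1 - c) / D) := by
      calc volume (S ∩ Metric.closedBall x (1 / D))
          ≤ volume (Metric.closedBall x (1 / D) \ Metric.ball y (c / D)) := by
            refine measure_mono fun z hz => ⟨hz.2, fun hz' => ?_⟩
            exact Set.disjoint_left.mp hdis hz.1 hz'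
        _ = volume (Metric.closedBall x (1 / D)) - volume (Metric.ball y (c / D)) :=
            measure_sdiff hsub Metric.isOpen_ball.measurableSet.nullMeasurableSet
              measure_ball_lt_top.ne
        _ = ENNReal.ofReal (2 * (1 - c) / D) := by
            rw [Real.volume_closedBall, Real.volume_ball, ← ENNReal.ofReal_sub _ (by positivity)]
            congr 1
            ring
    rw [Real.volume_closedBall]
    refine ENNReal.div_le_of_le_mul (hvol.trans ?_)
    rw [← ENNReal.ofReal_mul (by linarith)]
    apply ENNReal.ofReal_le_ofReal
    apply le_of_eq
    ring
  have h1 : (1 : ENNReal) ≤ ENNReal.ofReal (1 - c) := le_of_tendsto' hlim hbound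
  rw [ENNReal.one_le_ofReal] at h1
  linarith

/-! ### Paths under the Bernoulli measure -/

theorem measurable_pathColumn (n : ℕ) : Measurable fun x : PascalPath => pathColumn x n := by
  induction n with
  | zero => exact measurable_const
  | succ n ih =>
    have h : Measurable fun x : PascalPath => if x n = true then 1 else 0 :=
      (measurable_of_countable fun b : Bool => if b = true then 1 else 0).comp
        (measurable_pi_apply n)
    exact ih.add h

theorem measurable_pathBinom (n : ℕ) : Measurable fun x : PascalPath => pathBinom x n :=
  (measurable_of_countable (Nat.choose n)).comp (measurable_pathColumn n)

instance isProbabilityMeasure_pascalBernoulli (α : unitInterval) :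
    IsProbabilityMeasure (pascalBernoulli α) := by
  unfold pascalBernoulli
  infer_instance

theorem pascalBernoulli_eval_eq_true (α : unitInterval) (n : ℕ) :
    (pascalBernoulli α).real {x | x n = true} = α := by
  have h := congrArg (fun ν : Measure Bool => ν.real {true})
    (Measure.infinitePi_map_eval (fun _ : ℕ => bernoulliMeasure true false α) n)
  rw [map_measureReal_apply (measurable_pi_apply n) (by simp)] at h
  have hset : {x : PascalPath | x n = true} = (fun x => x n) ⁻¹' {true} := by ext; simp
  rw [hset]
  simpa [pascalBernoulli] using h

theorem pascalBernoulli_eval_eq_false (α : unitInterval) (n : ℕ) :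
    (pascalBernoulli α).real {x | x n = false} = 1 - α := by
  have h := congrArg (fun ν : Measure Bool => ν.real {false})
    (Measure.infinitePi_map_eval (fun _ : ℕ => bernoulliMeasure true false α) n)
  rw [map_measureReal_apply (measurable_pi_apply n) (by simp)] at h
  have hset : {x : PascalPath | x n = false} = (fun x => x n) ⁻¹' {false} := by ext; simp
  rw [hset]
  simpa [pascalBernoulli] using h

/-- Both labels occur in almost every path. -/
theorem ae_exists_label_eq (α : unitInterval) (hα0 : 0 < α) (hα1 : α < 1) (b : Bool) :
    ∀ᵐ x ∂pascalBernoulli α, ∃ n, x n = b := by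
  have hlt : bernoulliMeasure true false α {!b} < 1 := by
    rw [← ENNReal.toReal_lt_toReal (by simp) (by simp)]
    change (bernoulliMeasure true false α).real {!b} < _
    have h0 : (0 : ℝ) < α := hα0
    have h1 : (α : ℝ) < 1 := hα1
    cases b <;> simp [h0, h1]
  rw [ae_iff]
  refine le_antisymm (ge_of_tendsto'
    (ENNReal.tendsto_pow_atTop_nhds_zero_of_lt_one hlt) fun n => ?_) zero_le
  calc pascalBernoulli α {x | ¬∃ n, x n = b}
      ≤ pascalBernoulli α (Set.pi (Finset.range n) fun _ => {!b}) := by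
        refine measure_mono fun x hx i _ => ?_
        simp only [Set.mem_ofPred_eq, not_exists] at hx
        simpa [Bool.eq_not_iff] using hx i
    _ = _ := by
        rw [pascalBernoulli, Measure.infinitePi_pi _ (by simp)]
        simp

theorem Nat.le_choose_of_pos_of_lt {n k : ℕ} (hk : 0 < k) (hkn : k < n) : n ≤ n.choose k := by
  induction n generalizing k with
  | zero => omega
  | succ n ih =>
    obtain ⟨k, rfl⟩ : ∃ l, k = l + 1 := ⟨k - 1, by omega⟩
    rw [Nat.choose_succ_succ']
    have h1 : 0 < n.choose k := Nat.choose_pos (by omega)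
    rcases Nat.lt_or_ge (k + 1) n with h | h
    · have := ih (k := k + 1) (by omega) h
      omega
    · have : k + 1 = n := by omega
      subst this
      rw [Nat.choose_succ_self_right, Nat.choose_self]

theorem pathColumn_mono (x : PascalPath) : Monotone (pathColumn x) :=
  monotone_nat_of_le_succ fun n => by rw [pathColumn]; omega

theorem pathColumn_le (x : PascalPath) (n : ℕ) : pathColumn x n ≤ n := by
  induction n with
  | zero => exact le_rfl
  | succ n ih => rw [pathColumn]; split_ifs <;> omega

theorem pathColumn_pos {x : PascalPath} {m n : ℕ} (h : x m = true) (hmn : m < n) :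
    0 < pathColumn x n := by
  refine lt_of_lt_of_le ?_ (pathColumn_mono x (Nat.succ_le_of_lt hmn))
  simp [pathColumn, h]

theorem pathColumn_lt {x : PascalPath} {m n : ℕ} (h : x m = false) (hmn : m < n) :
    pathColumn x n < n := by
  induction n, (Nat.succ_le_of_lt hmn) using Nat.le_induction with
  | base =>
    have := pathColumn_le x m
    simp [pathColumn, h]
    omega
  | succ n hn ih =>
    have := ih hn
    rw [pathColumn]
    split_ifs <;> omega

/-- Once both labels have occurred, the column at level j is strictly between 0 and j, so the
coefficient is at least j. -/
theorem ae_pathBinom_unbounded (α : unitInterval) (hα0 : 0 < α) (hα1 : α < 1) :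
    ∀ᵐ x ∂pascalBernoulli α, ∀ n, ∃ j, n ≤ pathBinom x j := by
  filter_upwards [ae_exists_label_eq α hα0 hα1 true, ae_exists_label_eq α hα0 hα1 false]
    with x ⟨a, ha⟩ ⟨b, hb⟩ n
  refine ⟨n + a + b + 1, ?_⟩
  have := Nat.le_choose_of_pos_of_lt (pathColumn_pos ha (show a < n + a + b + 1 by omega))
    (pathColumn_lt hb (show b < n + a + b + 1 by omega))
  rw [pathBinom]
  omega

theorem measurableSet_pathRotation_mem (j : ℕ) {B : Set Circle} (hB : IsOpen B) :
    MeasurableSet {p : ℝ × PascalPath | pathRotation p.2 p.1 j ∈ B} := by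
  have h : Measurable fun p : ℝ × PascalPath => ((pathBinom p.2 j : ℕ) : ℝ) :=
    (measurable_of_countable (fun n : ℕ => (n : ℝ))).comp
      ((measurable_pathBinom j).comp measurable_snd)
  have h' : Measurable fun p : ℝ × PascalPath => 2 * Real.pi * (pathBinom p.2 j * p.1) :=
    measurable_const.mul (h.mul measurable_fst)
  exact h' (hB.preimage Circle.exp.continuous).measurableSet

theorem ae_ae_exists_pathRotation_mem (α : unitInterval) (hα0 : 0 < α) (hα1 : α < 1)
    {B : Set Circle} (hB : IsOpen B) (hBne : B.Nonempty) :
    ∀ᵐ θ : ℝ, ∀ᵐ x ∂pascalBernoulli α, ∃ j, pathRotation x θ j ∈ B := by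
  rw [Measure.ae_ae_comm]
  · filter_upwards [ae_pathBinom_unbounded α hα0 hα1] with x hx
    exact ae_exists_circleExp_mul_mem hx hB hBne
  · simp only [Set.ofPred_exists]
    exact MeasurableSet.iUnion fun j => measurableSet_pathRotation_mem j hB

/-! ### Equidistribution of columns modulo `M` -/

/-- Strict convexity of the disc; this is the spectral gap of the lazy shift. -/
theorem norm_convexCombo_one_lt_one {α : ℝ} (h0 : 0 < α) (h1 : α < 1) {z : ℂ} (hz : ‖z‖ = 1)
    (hz1 : z ≠ 1) : ‖((1 - α : ℝ) : ℂ) + (α : ℂ) * z‖ < 1 := by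
  have h := norm_combo_lt_of_ne (x := (1 : ℂ)) (y := z) (r := 1) (a := 1 - α) (b := α)
    (by simp) hz.le hz1.symm (by linarith) h0 (by ring)
  simpa [Complex.real_smul] using h

/-- Iterating a lazy shift on `ZMod M` converges to the uniform average. -/
theorem tendsto_average_of_lazy_shift {M : ℕ} [NeZero M] {α : ℝ} (h0 : 0 < α) (h1 : α < 1)
    {p : ℕ → ZMod M → ℝ}
    (hp : ∀ n b, p (n + 1) b = (1 - α) * p n b + α * p n (b - 1)) (b : ZMod M) :
    Tendsto (fun n => p n b) atTop (𝓝 ((∑ c, p 0 c) / M)) := by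
  set P : ℕ → ZMod M → ℂ := fun n k => ZMod.dft (fun c => (p n c : ℂ)) k with hP
  -- The Fourier transform diagonalizes the shift, so only the frequency `k = 0` survives iteration.
  have hrec : ∀ n k, P (n + 1) k =
      (((1 - α : ℝ) : ℂ) + (α : ℂ) * ZMod.stdAddChar (-k)) * P n k := by
    intro n k
    simp only [hP, ZMod.dft_apply, smul_eq_mul]
    have hshift : ∑ j : ZMod M, (ZMod.stdAddChar (-(j * k)) : ℂ) * (p n (j - 1) : ℂ) =
        ZMod.stdAddChar (-k) * ∑ j : ZMod M, (ZMod.stdAddChar (-(j * k)) : ℂ) * (p n j : ℂ) := by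
      rw [← Equiv.sum_comp (Equiv.addRight (1 : ZMod M)), Finset.mul_sum]
      refine Finset.sum_congr rfl fun j _ => ?_
      rw [Equiv.coe_addRight, add_sub_cancel_right, ← mul_assoc, ← AddChar.map_add_eq_mul]
      congr 3
      ring
    rw [add_mul, mul_assoc (α : ℂ), ← hshift, Finset.mul_sum, Finset.mul_sum,
      ← Finset.sum_add_distrib]
    refine Finset.sum_congr rfl fun j _ => ?_
    rw [hp]
    push_cast
    ring
  have hclosed : ∀ n k, P n k =
      (((1 - α : ℝ) : ℂ) + (α : ℂ) * ZMod.stdAddChar (-k)) ^ n * P 0 k := by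
    intro n k
    induction n with
    | zero => simp
    | succ n ih => rw [hrec, ih]; ring
  have hlim : ∀ k, Tendsto (fun n => P n k) atTop
      (𝓝 (if k = 0 then ∑ c, (p 0 c : ℂ) else 0)) := by
    intro k
    split_ifs with hk
    · subst hk
      have : ∀ n, P n 0 = ∑ c, (p 0 c : ℂ) := by
        intro n
        rw [hclosed]
        simp [hP, ZMod.dft_apply_zero]
      simp_rw [this]
      exact tendsto_const_nhds
    · rw [funext fun n => hclosed n k]
      have hlt : ‖((1 - α : ℝ) : ℂ) + (α : ℂ) * ZMod.stdAddChar (-k)‖ < 1 := by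
        refine norm_convexCombo_one_lt_one h0 h1 (AddChar.norm_apply _ _) ?_
        rw [← AddChar.map_zero_eq_one (ZMod.stdAddChar (N := M)), ne_eq,
          ZMod.injective_stdAddChar.eq_iff, neg_eq_zero]
        exact hk
      simpa using (tendsto_pow_atTop_nhds_zero_of_norm_lt_one hlt).mul_const (P 0 k)
  have hinv : ∀ n, (p n b : ℂ) = (M : ℂ)⁻¹ * ∑ k : ZMod M, ZMod.stdAddChar (k * b) * P n k := by
    intro n
    have h := congrFun (ZMod.dft.symm_apply_apply (fun c => (p n c : ℂ))) b
    rw [ZMod.invDFT_apply] at h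
    simpa [hP] using h.symm
  have hsum := (tendsto_finsetSum Finset.univ fun (k : ZMod M) _ =>
    (hlim k).const_mul (ZMod.stdAddChar (k * b) : ℂ)).const_mul ((M : ℂ)⁻¹)
  simp_rw [← hinv] at hsum
  have hval : (M : ℂ)⁻¹ * ∑ k : ZMod M, (ZMod.stdAddChar (k * b) : ℂ) *
      (if k = 0 then ∑ c, (p 0 c : ℂ) else 0) = (((∑ c, p 0 c) / M : ℝ) : ℂ) := by
    simp [div_eq_inv_mul]
  rw [hval] at hsum
  exact_mod_cast (Complex.continuous_re.tendsto _).comp hsum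

theorem pathColumn_eq_sum (x : PascalPath) (n : ℕ) :
    pathColumn x n = ∑ i ∈ Finset.range n, if x i = true then 1 else 0 := by
  induction n with
  | zero => rfl
  | succ n ih => rw [pathColumn, Finset.sum_range_succ, ih]

/-- The label at level `n` is independent of the column at level `n`. -/
theorem indepFun_pathColumn_eval (α : unitInterval) (n : ℕ) :
    IndepFun (fun x : PascalPath => pathColumn x n)
      (fun x => if x n = true then 1 else 0) (pascalBernoulli α) := by
  have hm : ∀ i : ℕ, Measurable fun b : Bool => if b = true then 1 else 0 :=
    fun _ => measurable_of_countable _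
  have h := (iIndepFun_infinitePi (P := fun _ : ℕ => bernoulliMeasure true false α)
    (X := fun _ (b : Bool) => if b = true then 1 else 0) hm).indepFun_sum_range_succ
      (fun i => (hm i).comp (measurable_pi_apply i)) n
  have hsum : (fun x : PascalPath => pathColumn x n) =
      ∑ j ∈ Finset.range n, fun x : PascalPath => if x j = true then 1 else 0 := by
    ext x
    simp [pathColumn_eq_sum]
  rw [hsum]
  exact h

/-- Conditioning on the last label, which is independent of the column, gives the lazy shift
recursion. -/
theorem pascalBernoulli_pathColumn_succ (α : unitInterval) (M n : ℕ) (b : ZMod M) :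
    (pascalBernoulli α).real {x | (pathColumn x (n + 1) : ZMod M) = b} =
      (1 - α) * (pascalBernoulli α).real {x | (pathColumn x n : ZMod M) = b} +
      α * (pascalBernoulli α).real {x | (pathColumn x n : ZMod M) = b - 1} := by
  set μ := pascalBernoulli α
  have hind : ∀ (c : ZMod M) (e : ℕ),
      μ.real ({x | (pathColumn x n : ZMod M) = c} ∩ {x | (if x n = true then 1 else 0) = e}) =
      μ.real {x | (pathColumn x n : ZMod M) = c} *
        μ.real {x | (if x n = true then 1 else 0) = e} := by
    intro c e
    have h := congrArg ENNReal.toReal ((indepFun_pathColumn_eval α n).measure_inter_preimage_eq_mul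
      {k : ℕ | (k : ZMod M) = c} {e} MeasurableSet.of_discrete MeasurableSet.of_discrete)
    rw [ENNReal.toReal_mul] at h
    exact h
  have hme : ∀ e : Bool, MeasurableSet {x : PascalPath | x n = e} := fun e =>
    measurableSet_eq_fun (measurable_pi_apply n) measurable_const
  have hmn : ∀ c : ZMod M, MeasurableSet {x : PascalPath | (pathColumn x n : ZMod M) = c} :=
    fun c => measurable_pathColumn n (MeasurableSet.of_discrete (s := {k : ℕ | (k : ZMod M) = c}))
  have ht : {x : PascalPath | (if x n = true then 1 else 0) = 1} = {x | x n = true} := by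
    ext x; simp
  have hf : {x : PascalPath | (if x n = true then 1 else 0) = 0} = {x | x n = false} := by
    ext x; simp
  have hsplit : {x : PascalPath | (pathColumn x (n + 1) : ZMod M) = b} =
      ({x | (pathColumn x n : ZMod M) = b} ∩ {x | x n = false}) ∪
      ({x | (pathColumn x n : ZMod M) = b - 1} ∩ {x | x n = true}) := by
    ext x
    cases hx : x n <;> simp [pathColumn, hx, eq_sub_iff_add_eq]
  rw [hsplit, measureReal_union _ ((hmn _).inter (hme _)), ← ht, ← hf, hind, hind, ht, hf,
    pascalBernoulli_eval_eq_true, pascalBernoulli_eval_eq_false]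
  · ring
  · rw [Set.disjoint_left]
    rintro x ⟨-, hx⟩ ⟨-, hx'⟩
    simp_all

/-- The columns of a random path are asymptotically equidistributed modulo `M`. -/
theorem tendsto_pascalBernoulli_pathColumn_eq (α : unitInterval) (hα0 : 0 < α) (hα1 : α < 1)
    (M : ℕ) [NeZero M] (b : ZMod M) :
    Tendsto (fun n => (pascalBernoulli α).real {x | (pathColumn x n : ZMod M) = b}) atTop
      (𝓝 (1 / M)) := by
  have h := tendsto_average_of_lazy_shift (M := M) (α := α) hα0 hα1
    (p := fun n b => (pascalBernoulli α).real {x | (pathColumn x n : ZMod M) = b})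
    (fun n b => pascalBernoulli_pathColumn_succ α M n b) b
  have h1 : ∑ c : ZMod M,
      (pascalBernoulli α).real {x | (pathColumn x 0 : ZMod M) = c} = 1 := by
    rw [Finset.sum_eq_single 0]
    · simp [pathColumn]
    · intro c _ hc
      simp [pathColumn, hc.symm]
    · simp
  rwa [h1] at h

/-! ### Divisibility of binomial coefficients by a prime -/

/-- The pairs of residues modulo `q ^ r` for which the binomial coefficient is prime to `q`. -/
def chooseNotDvdPairs (q r : ℕ) : Finset (ℕ × ℕ) :=
  (Finset.range (q ^ r) ×ˢ Finset.range (q ^ r)).filter fun p => ¬ q ∣ p.1.choose p.2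

theorem Nat.Prime.not_dvd_choose_iff {q : ℕ} (hq : q.Prime) (n k : ℕ) :
    ¬ q ∣ n.choose k ↔ ¬ q ∣ (n % q).choose (k % q) ∧ ¬ q ∣ (n / q).choose (k / q) := by
  have := Fact.mk hq
  rw [(Choose.choose_modEq_choose_mod_mul_choose_div_nat (n := n) (k := k) (p := q)).dvd_iff
    dvd_rfl, hq.dvd_mul, not_or]

/-- Lucas's criterion is digitwise, so discarding the high base-`q` digits preserves it. -/
theorem not_dvd_choose_mod_pow {q : ℕ} (hq : q.Prime) (r : ℕ) {n k : ℕ}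
    (h : ¬ q ∣ n.choose k) : ¬ q ∣ (n % q ^ r).choose (k % q ^ r) := by
  induction r generalizing n k with
  | zero => simpa [Nat.mod_one] using hq.one_lt.ne'
  | succ r ih =>
    rw [hq.not_dvd_choose_iff] at h ⊢
    rw [pow_succ', Nat.mod_mul_right_mod, Nat.mod_mul_right_mod, Nat.mod_mul_right_div_self,
      Nat.mod_mul_right_div_self]
    exact ⟨h.1, ih h.2⟩

theorem card_chooseNotDvdPairs_le {q : ℕ} (hq : q.Prime) (r : ℕ) :
    (chooseNotDvdPairs q r).card ≤ (q ^ 2 - 1) ^ r := by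
  induction r with
  | zero =>
    refine (Finset.card_filter_le _ _).trans ?_
    simp
  | succ r ih =>
    have hone : (chooseNotDvdPairs q 1).card ≤ q ^ 2 - 1 := by
      -- C(0, 1) = 0 is divisible by `q`, so at least one of the `q²` digit pairs is lost.
      have hss : chooseNotDvdPairs q 1 ⊆ (Finset.range q ×ˢ Finset.range q).erase (0, 1) := by
        intro p hp
        simp only [chooseNotDvdPairs, pow_one, Finset.mem_filter] at hp
        refine Finset.mem_erase.mpr ⟨?_, hp.1⟩
        rintro rfl
        simp at hp
      refine (Finset.card_le_card hss).trans ?_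
      rw [Finset.card_erase_of_mem (by simp [hq.pos, hq.one_lt])]
      simp [sq]
    calc (chooseNotDvdPairs q (r + 1)).card
        ≤ (chooseNotDvdPairs q 1 ×ˢ chooseNotDvdPairs q r).card := by
          -- Split off the lowest base-`q` digit of both entries.
          refine Finset.card_le_card_of_injOn
            (fun p => ((p.1 % q, p.2 % q), (p.1 / q, p.2 / q))) ?_ ?_
          · rintro ⟨a, b⟩ hp
            simp only [chooseNotDvdPairs, Finset.coe_filter, Finset.mem_product, Finset.mem_range,
              Set.mem_ofPred_eq] at hp
            obtain ⟨⟨ha, hb⟩, hab⟩ := hp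
            rw [hq.not_dvd_choose_iff] at hab
            simp only [chooseNotDvdPairs, Finset.coe_product, Set.mem_prod, Finset.coe_filter,
              Finset.mem_product, Finset.mem_range, Set.mem_ofPred_eq, pow_one]
            rw [pow_succ'] at ha hb
            exact ⟨⟨⟨Nat.mod_lt _ hq.pos, Nat.mod_lt _ hq.pos⟩, hab.1⟩,
              ⟨Nat.div_lt_of_lt_mul ha, Nat.div_lt_of_lt_mul hb⟩, hab.2⟩
          · rintro ⟨a, b⟩ _ ⟨c, d⟩ _ h
            simp only [Prod.mk.injEq] at h
            obtain ⟨⟨h1, h2⟩, h3, h4⟩ := h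
            rw [Prod.mk.injEq, ← Nat.mod_add_div a q, ← Nat.mod_add_div b q,
              ← Nat.mod_add_div c q, ← Nat.mod_add_div d q, h1, h2, h3, h4]
            exact ⟨rfl, rfl⟩
      _ ≤ (q ^ 2 - 1) ^ (r + 1) := by
          rw [Finset.card_product, pow_succ']
          gcongr

theorem sum_range_mul_mod (g : ℕ → ℝ) (M T : ℕ) :
    ∑ n ∈ Finset.range (M * T), g (n % M) = T * ∑ m ∈ Finset.range M, g m := by
  induction T with
  | zero => simp
  | succ T ih =>
    rw [Nat.mul_succ, Finset.sum_range_add, ih]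
    have : ∑ x ∈ Finset.range M, g ((M * T + x) % M) = ∑ m ∈ Finset.range M, g m :=
      Finset.sum_congr rfl fun x hx => by
        rw [Nat.mul_add_mod, Nat.mod_eq_of_lt (Finset.mem_range.mp hx)]
    rw [this]
    push_cast
    ring

/-- Comparison of the probability that `q` does not divide `d_n` with its value for a column
uniformly distributed modulo `q ^ r`. -/
theorem pascalBernoulli_not_dvd_pathBinom_le (α : unitInterval) {q : ℕ} (hq : q.Prime) (r n : ℕ) :
    (pascalBernoulli α).real {x | ¬ q ∣ pathBinom x n} ≤
      ((Finset.range (q ^ r)).filter fun k => ¬ q ∣ (n % q ^ r).choose k).card / (q ^ r : ℕ) +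
      ∑ k ∈ Finset.range (q ^ r),
        |(pascalBernoulli α).real {x | (pathColumn x n : ZMod (q ^ r)) = (k : ZMod (q ^ r))} -
          1 / (q ^ r : ℕ)| := by
  set μ := pascalBernoulli α
  set M := q ^ r with hM
  have hMpos : 0 < M := pow_pos hq.pos r
  set G := (Finset.range M).filter fun k => ¬ q ∣ (n % M).choose k with hG
  have hsub : {x : PascalPath | ¬ q ∣ pathBinom x n} ⊆
      ⋃ k ∈ G, {x | (pathColumn x n : ZMod M) = (k : ZMod M)} := by
    intro x hx
    refine Set.mem_biUnion (x := pathColumn x n % M) ?_ ?_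
    · simp only [hG, Finset.coe_filter, Finset.mem_range, Set.mem_ofPred_eq]
      exact ⟨Nat.mod_lt _ hMpos, not_dvd_choose_mod_pow hq r hx⟩
    · simp
  calc μ.real {x | ¬ q ∣ pathBinom x n}
      ≤ μ.real (⋃ k ∈ G, {x | (pathColumn x n : ZMod M) = (k : ZMod M)}) :=
        measureReal_mono hsub (measure_ne_top _ _)
    _ ≤ ∑ k ∈ G, μ.real {x | (pathColumn x n : ZMod M) = (k : ZMod M)} :=
        measureReal_biUnion_finset_le _ _
    _ ≤ ∑ k ∈ G, (1 / (M : ℝ) +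
          |μ.real {x | (pathColumn x n : ZMod M) = (k : ZMod M)} - 1 / (M : ℝ)|) := by
        refine Finset.sum_le_sum fun k _ => ?_
        linarith [le_abs_self (μ.real {x | (pathColumn x n : ZMod M) = (k : ZMod M)} - 1 / (M : ℝ))]
    _ ≤ _ := by
        rw [Finset.sum_add_distrib, Finset.sum_const, nsmul_eq_mul, mul_one_div]
        gcongr
        exact Finset.filter_subset _ _

/-- For a prime `q`, the expected proportion of binomial coefficients prime to `q` along a random
path is arbitrarily small at arbitrarily late times. -/
theorem exists_sum_pascalBernoulli_not_dvd_le (α : unitInterval) (hα0 : 0 < α) (hα1 : α < 1)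
    {q : ℕ} (hq : q.Prime) {ε : ℝ} (hε : 0 < ε) (i : ℕ) :
    ∃ N, i < N ∧
      ∑ n ∈ Finset.range N, (pascalBernoulli α).real {x | ¬ q ∣ pathBinom x n} ≤ ε * N := by
  have hq1 : (1 : ℝ) < q := by exact_mod_cast hq.one_lt
  have hratio : 1 - 1 / (q : ℝ) ^ 2 < 1 := by
    have : 0 < 1 / (q : ℝ) ^ 2 := by positivity
    linarith
  have hratio0 : 0 ≤ 1 - 1 / (q : ℝ) ^ 2 := by
    rw [sub_nonneg, div_le_one (by positivity)]
    nlinarith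
  obtain ⟨r, hr⟩ := exists_pow_lt_of_lt_one (half_pos hε) hratio
  set M := q ^ r with hM
  have hMpos : 0 < M := pow_pos hq.pos r
  have hMR : (0 : ℝ) < M := by exact_mod_cast hMpos
  have : NeZero M := ⟨hMpos.ne'⟩
  set e : ℕ → ℝ := fun n => ∑ k ∈ Finset.range M,
    |(pascalBernoulli α).real {x | (pathColumn x n : ZMod M) = (k : ZMod M)} - 1 / (M : ℕ)| with he
  set g : ℕ → ℝ := fun m => ((Finset.range M).filter fun k => ¬ q ∣ m.choose k).card with hg
  have he0 : Tendsto e atTop (𝓝 0) := by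
    have h := tendsto_finsetSum (Finset.range M) fun k _ =>
      ((tendsto_pascalBernoulli_pathColumn_eq α hα0 hα1 M (k : ZMod M)).sub_const
        (1 / (M : ℝ))).abs
    simpa only [sub_self, abs_zero, Finset.sum_const_zero] using h
  have hces := he0.cesaro
  obtain ⟨N₀, hN₀⟩ := eventually_atTop.mp (hces.eventually (gt_mem_nhds (half_pos hε)))
  have hgsum : ∑ m ∈ Finset.range M, g m = (chooseNotDvdPairs q r).card := by
    simp only [hg, chooseNotDvdPairs, ← hM]
    rw [Finset.card_filter, Finset.sum_product]
    push_cast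
    refine Finset.sum_congr rfl fun m _ => ?_
    rw [Finset.card_filter]
    push_cast
    rfl
  have hcard : ((chooseNotDvdPairs q r).card : ℝ) ≤ ε / 2 * (M : ℝ) ^ 2 := by
    have h1 : ((chooseNotDvdPairs q r).card : ℝ) ≤ ((q : ℝ) ^ 2 - 1) ^ r := by
      have := card_chooseNotDvdPairs_le hq r
      have h2 : (((q ^ 2 - 1 : ℕ) : ℝ)) = (q : ℝ) ^ 2 - 1 := by
        rw [Nat.cast_sub (Nat.one_le_pow _ _ hq.pos)]
        push_cast
        rfl
      rw [← h2]
      exact_mod_cast this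
    have h3 : ((q : ℝ) ^ 2 - 1) ^ r = (1 - 1 / (q : ℝ) ^ 2) ^ r * (M : ℝ) ^ 2 := by
      rw [hM]
      push_cast
      rw [← pow_mul, mul_comm r 2, pow_mul, ← mul_pow]
      congr 1
      field_simp
    rw [h3] at h1
    refine h1.trans ?_
    gcongr
  -- The time `M * T` consists of whole periods modulo `M`, and exceeds both `i` and the Cesàro
  -- threshold `N₀`.
  set T := N₀ + i + 1 with hT
  have hTN : T ≤ M * T := Nat.le_mul_of_pos_left T hMpos
  refine ⟨M * T, by omega, ?_⟩
  have hNpos : (0 : ℝ) < (M * T : ℕ) := by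
    have : 0 < M * T := by omega
    exact_mod_cast this
  have hesum : ∑ n ∈ Finset.range (M * T), e n ≤ ε / 2 * (M * T : ℕ) := by
    have := (hN₀ (M * T) (by omega)).le
    rwa [inv_mul_le_iff₀ hNpos, mul_comm _ (ε / 2)] at this
  calc ∑ n ∈ Finset.range (M * T), (pascalBernoulli α).real {x | ¬ q ∣ pathBinom x n}
      ≤ ∑ n ∈ Finset.range (M * T), (g (n % M) / M + e n) :=
        Finset.sum_le_sum fun n _ => pascalBernoulli_not_dvd_pathBinom_le α hq r n
    _ = T * (chooseNotDvdPairs q r).card / M + ∑ n ∈ Finset.range (M * T), e n := by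
        rw [Finset.sum_add_distrib, ← Finset.sum_div, sum_range_mul_mod, hgsum]
    _ ≤ T * (ε / 2 * (M : ℝ) ^ 2) / M + ε / 2 * (M * T : ℕ) := by gcongr
    _ = ε * (M * T : ℕ) := by
        push_cast
        field_simp
        ring

/-- For a prime `q`, along almost every path there are arbitrarily late times up to which most
binomial coefficients are divisible by `q`. -/
theorem ae_exists_lt_two_mul_card_dvd (α : unitInterval) (hα0 : 0 < α) (hα1 : α < 1)
    {q : ℕ} (hq : q.Prime) (i : ℕ) :
    ∀ᵐ x ∂pascalBernoulli α, ∃ N, i < N ∧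
      N < 2 * ((Finset.range N).filter fun j => q ∣ pathBinom x j).card := by
  set μ := pascalBernoulli α
  rw [ae_iff, ← measureReal_eq_zero_iff]
  refine le_antisymm (le_of_forall_pos_le_add fun ε hε => ?_) measureReal_nonneg
  rw [zero_add]
  obtain ⟨N, hiN, hN⟩ := exists_sum_pascalBernoulli_not_dvd_le α hα0 hα1 hq (half_pos hε) i
  have hNpos : (0 : ℝ) < N := by exact_mod_cast (by omega : 0 < N)
  have hms : ∀ n, MeasurableSet {x : PascalPath | ¬ q ∣ pathBinom x n} := fun n =>
    measurable_pathBinom n (MeasurableSet.of_discrete (s := {k : ℕ | ¬ q ∣ k}))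
  set f : PascalPath → ℝ := fun x => ∑ n ∈ Finset.range N,
    {x : PascalPath | ¬ q ∣ pathBinom x n}.indicator 1 x with hf
  have hfi : ∀ n ∈ Finset.range N,
      Integrable ({x : PascalPath | ¬ q ∣ pathBinom x n}.indicator (1 : PascalPath → ℝ)) μ :=
    fun n _ => (integrable_const (1 : ℝ)).indicator (hms n)
  have hint : ∫ x, f x ∂μ =
      ∑ n ∈ Finset.range N, μ.real {x | ¬ q ∣ pathBinom x n} := by
    rw [hf, integral_finsetSum _ hfi]
    exact Finset.sum_congr rfl fun n _ => integral_indicator_one (hms n)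
  -- Failure at `N` means at least `N / 2` coefficients prime to `q`; the mean is at most `ε / 2 *
  -- N`, so this has probability at most `ε`.
  have hmarkov := mul_meas_ge_le_integral_of_nonneg (μ := μ) (f := f)
    (Eventually.of_forall fun x => Finset.sum_nonneg fun n _ =>
      Set.indicator_nonneg (fun _ _ => zero_le_one) x)
    (integrable_finsetSum _ hfi) ((N : ℝ) / 2)
  have hle : μ.real {x | ¬ ∃ N, i < N ∧
      N < 2 * ((Finset.range N).filter fun j => q ∣ pathBinom x j).card} ≤
      μ.real {x | (N : ℝ) / 2 ≤ f x} := by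
    refine measureReal_mono fun x hx => ?_
    simp only [Set.mem_ofPred_eq, not_exists, not_and, not_lt] at hx ⊢
    have hx := hx N hiN
    have hfx : f x = ((Finset.range N).filter fun j => ¬ q ∣ pathBinom x j).card := by
      rw [Finset.card_filter]
      push_cast
      refine Finset.sum_congr rfl fun n _ => ?_
      simp [Set.indicator_apply]
    have hadd := Finset.card_filter_add_card_filter_not (s := Finset.range N)
      fun j => q ∣ pathBinom x j
    rw [Finset.card_range] at hadd
    have : (N : ℝ) ≤ 2 * f x := by
      rw [hfx]
      exact_mod_cast (by omega)
    linarith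
  rw [hint] at hmarkov
  have hfin : (N : ℝ) / 2 * μ.real {x | (N : ℝ) / 2 ≤ f x} ≤ ε / 2 * N := hmarkov.trans hN
  refine hle.trans ?_
  nlinarith

/-! ### Prime denominators, persistence and clustering near 1 -/

theorem dense_setOf_int_div_prime :
    Dense {θ : ℝ | ∃ (p : ℤ) (q : ℕ), q.Prime ∧ θ = p / q} := by
  rw [Metric.dense_iff]
  intro θ δ hδ
  obtain ⟨n, hn⟩ := exists_nat_gt (1 / δ)
  obtain ⟨q, hqn, hq⟩ := Nat.exists_infinite_primes n
  have hq0 : (0 : ℝ) < q := by exact_mod_cast hq.pos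
  refine ⟨round (q * θ) / q, ?_, round (q * θ), q, hq, rfl⟩
  rw [Metric.mem_ball, dist_comm, Real.dist_eq]
  have h1 : θ - round (q * θ) / q = (q * θ - round (q * θ)) / q := by field_simp
  rw [h1, abs_div, abs_of_pos hq0, div_lt_iff₀ hq0]
  have h2 : 1 / δ < q := hn.trans_le (by exact_mod_cast hqn)
  rw [div_lt_iff₀ hδ] at h2
  have h3 := abs_sub_round ((q : ℝ) * θ)
  linarith

theorem pathRotation_eq_one_of_dvd {x : PascalPath} {j q : ℕ} (hq : q ≠ 0) (p : ℤ)
    (h : q ∣ pathBinom x j) : pathRotation x (p / q) j = 1 := by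
  obtain ⟨c, hc⟩ := h
  have : ((pathBinom x j : ℝ) * ((p : ℝ) / q)) = ((c * p : ℤ) : ℝ) := by
    rw [hc]
    push_cast
    field_simp
  rw [pathRotation, this, Circle.exp_two_pi_mul_int]

/-- At a fixed level, membership of the rotated points in an open set persists for nearby angles,
uniformly over all paths. -/
theorem eventually_forall_pathRotation_mem {B : Set Circle} (hB : IsOpen B) (j : ℕ) (θ₀ : ℝ) :
    ∀ᶠ θ in 𝓝 θ₀, ∀ x, pathRotation x θ₀ j ∈ B → pathRotation x θ j ∈ B := by
  -- At level `j` only `j + 1` coefficients are possible, which makes the neighbourhood independent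
  -- of the path.
  have h : ∀ᶠ θ in 𝓝 θ₀, ∀ k ∈ Finset.range (j + 1),
      Circle.exp (2 * Real.pi * (j.choose k * θ₀)) ∈ B →
        Circle.exp (2 * Real.pi * (j.choose k * θ)) ∈ B := by
    refine (Finset.eventually_all _).mpr fun k _ => ?_
    by_cases hk : Circle.exp (2 * Real.pi * (j.choose k * θ₀)) ∈ B
    · have hc : Continuous fun θ : ℝ => Circle.exp (2 * Real.pi * (j.choose k * θ)) := by fun_prop
      filter_upwards [hc.continuousAt.eventually_mem (hB.mem_nhds hk)] with θ hθ _ using hθ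
    · exact Eventually.of_forall fun θ h => absurd h hk
  filter_upwards [h] with θ hθ x hx
  exact hθ (pathColumn x j) (Finset.mem_range_succ_iff.mpr (pathColumn_le x j)) hx

open Classical in
/-- The event that more than half of the first `n` rotated points lie in `B`. -/
def mostRotationsMem (B : Set Circle) (n : ℕ) (θ : ℝ) : Set PascalPath :=
  {x | n < 2 * ((Finset.range n).filter fun j => pathRotation x θ j ∈ B).card}

theorem measurableSet_setOf_pathRotation_mem {B : Set Circle} (hB : IsOpen B) (j : ℕ) (θ : ℝ) :
    MeasurableSet {x : PascalPath | pathRotation x θ j ∈ B} :=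
  measurable_prodMk_left (measurableSet_pathRotation_mem j hB)

theorem measurableSet_mostRotationsMem {B : Set Circle} (hB : IsOpen B) (n : ℕ) (θ : ℝ) :
    MeasurableSet (mostRotationsMem B n θ) := by
  classical
  have h : Measurable fun x : PascalPath =>
      ((Finset.range n).filter fun j => pathRotation x θ j ∈ B).card := by
    simp only [Finset.card_filter]
    exact Finset.measurable_sum _ fun j _ =>
      Measurable.ite (measurableSet_setOf_pathRotation_mem hB j θ) measurable_const measurable_const
  have := h (MeasurableSet.of_discrete (s := {k : ℕ | n < 2 * k}))
  convert this using 1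
  ext x
  simp only [mostRotationsMem, Set.mem_ofPred_eq, Set.mem_preimage]

theorem eventually_mostRotationsMem_subset {B : Set Circle} (hB : IsOpen B) (n : ℕ) (θ₀ : ℝ) :
    ∀ᶠ θ in 𝓝 θ₀, mostRotationsMem B n θ₀ ⊆ mostRotationsMem B n θ := by
  classical
  have h : ∀ᶠ θ in 𝓝 θ₀, ∀ j ∈ Finset.range n, ∀ x,
      pathRotation x θ₀ j ∈ B → pathRotation x θ j ∈ B :=
    (Finset.eventually_all _).mpr fun j _ => eventually_forall_pathRotation_mem hB j θ₀
  filter_upwards [h] with θ hθ x hx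
  refine lt_of_lt_of_le hx (Nat.mul_le_mul_left 2 (Finset.card_le_card fun j hj => ?_))
  rw [Finset.mem_filter] at hj ⊢
  exact ⟨hj.1, hθ j hj.1 x hj.2⟩

theorem ae_exists_mem_mostRotationsMem (α : unitInterval) (hα0 : 0 < α) (hα1 : α < 1)
    {B : Set Circle} (hB : 1 ∈ B) (p : ℤ) {q : ℕ} (hq : q.Prime) (i : ℕ) :
    ∀ᵐ x ∂pascalBernoulli α, ∃ N, x ∈ mostRotationsMem B (i + N) (p / q) := by
  classical
  filter_upwards [ae_exists_lt_two_mul_card_dvd α hα0 hα1 hq i] with x ⟨N, hiN, hN⟩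
  refine ⟨N - i, ?_⟩
  rw [Nat.add_sub_cancel' hiN.le]
  refine lt_of_lt_of_le hN (Nat.mul_le_mul_left 2 (Finset.card_le_card fun j hj => ?_))
  rw [Finset.mem_filter] at hj ⊢
  refine ⟨hj.1, ?_⟩
  rw [pathRotation_eq_one_of_dvd hq.ne_zero p hj.2]
  exact hB

/-- Uniform distribution would force the proportion in the arc to tend to its length, below 1/2, yet
it exceeds 1/2 at arbitrarily late times. -/
theorem not_circleUniformlyDistributed_of_mostRotationsMem {B : Set Circle} {a b : ℝ}
    (hab : a ≤ b) (hlt : b < a + 1 / 2) (hB : B ⊆ circleArc a b) {x : PascalPath} {θ : ℝ}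
    (h : ∀ i, ∃ N, x ∈ mostRotationsMem B (i + N) θ) :
    ¬ CircleUniformlyDistributed (pathRotation x θ) := by
  classical
  intro hu
  have hev := (hu a b hab (by linarith)).eventually (gt_mem_nhds (show b - a < 1 / 2 by linarith))
  obtain ⟨N₀, hN₀⟩ := eventually_atTop.mp hev
  obtain ⟨N, hN⟩ := h (N₀ + 1)
  set n := N₀ + 1 + N with hn
  have h1 := hN₀ n (by omega)
  have hnpos : (0 : ℝ) < n := by exact_mod_cast (by omega : 0 < n)
  rw [div_lt_iff₀ hnpos] at h1
  have h2 : n < 2 * ((Finset.range n).filter fun j => pathRotation x θ j ∈ circleArc a b).card := by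
    refine lt_of_lt_of_le hN (Nat.mul_le_mul_left 2 (Finset.card_le_card fun j hj => ?_))
    rw [Finset.mem_filter] at hj ⊢
    exact ⟨hj.1, hB hj.2⟩
  have h3 : (n : ℝ) <
      2 * ((Finset.range n).filter fun j => pathRotation x θ j ∈ circleArc a b).card := by
    exact_mod_cast h2
  have h4 : (n : ℝ) < 2 * (1 / 2 * n) := by
    refine h3.trans ?_
    gcongr
  linarith

/-! ### Restriction to [0, 1) and conclusion -/

/-- The half-open interval is not open, but its nonempty relatively open subsets meet the open
interval. -/
theorem Dense.preimage_subtypeVal_Ico {G : Set ℝ} (hG : Dense G) (a b : ℝ) :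
    Dense ((↑) ⁻¹' G : Set (Set.Ico a b)) := by
  rw [dense_iff_inter_open]
  rintro U hU ⟨⟨u, hu⟩, huU⟩
  obtain ⟨O, hO, rfl⟩ := isOpen_induced_iff.mp hU
  have hab : a < b := hu.1.trans_lt hu.2
  have hcl : u ∈ closure (Set.Ioo a b) := by
    rw [closure_Ioo hab.ne]
    exact Set.Ico_subset_Icc_self hu
  have hne : (O ∩ Set.Ioo a b).Nonempty := mem_closure_iff.mp hcl O hO huU
  obtain ⟨g, ⟨hgO, hgI⟩, hgG⟩ := hG.inter_open_nonempty _ (hO.inter isOpen_Ioo) hne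
  exact ⟨⟨g, Set.Ioo_subset_Ico_self hgI⟩, hgO, hgG⟩

theorem theorem5p4 (α : ℝ) (hα0 : 0 < α) (hα1 : α < 1) :
    ∃ (Λ : Set (Set.Ico (0 : ℝ) 1)) (Y : Set PascalPath),
      IsGδ Λ ∧ Dense Λ ∧
      MeasurableSet Y ∧ pascalBernoulli ⟨α, hα0.le, hα1.le⟩ Y = 1 ∧
      ∀ θ ∈ Λ, ∀ x ∈ Y,
        Dense (Set.range (pathRotation x θ)) ∧
        ¬ CircleUniformlyDistributed (pathRotation x θ) := by
  set β : unitInterval := ⟨α, hα0.le, hα1.le⟩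
  have hβ0 : 0 < β := hα0
  have hβ1 : β < 1 := hα1
  obtain ⟨b, hbc, hbe, hbasis⟩ := TopologicalSpace.exists_countable_basis Circle
  have hbne : b.Nonempty := by
    obtain ⟨o, ho, -⟩ := hbasis.exists_subset_of_mem_open (Set.mem_univ (1 : Circle)) isOpen_univ
    exact ⟨o, ho⟩
  obtain ⟨B, rfl⟩ := hbc.exists_eq_range hbne
  have hBo : ∀ i, IsOpen (B i) := fun i => hbasis.isOpen ⟨i, rfl⟩
  have hBne : ∀ i, (B i).Nonempty := fun i => Set.nonempty_iff_ne_empty.mpr fun h => hbe ⟨i, h⟩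
  -- An open arc of normalized length 1/4: openness gives persistence, length below 1/2 gives the
  -- contradiction.
  set A : Set Circle := Circle.exp '' Set.Ioo (-(Real.pi / 4)) (Real.pi / 4) with hA
  have hAo : IsOpen A := isLocalHomeomorph_circleExp.isOpenMap _ isOpen_Ioo
  have hA1 : (1 : Circle) ∈ A := ⟨0, by constructor <;> linarith [Real.pi_pos], Circle.exp_zero⟩
  have hAarc : A ⊆ circleArc (-1 / 8) (1 / 8) := by
    rintro _ ⟨s, ⟨hs1, hs2⟩, rfl⟩
    refine ⟨s / (2 * Real.pi), ⟨?_, ?_⟩, ?_⟩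
    · rw [le_div_iff₀ Real.two_pi_pos]
      linarith
    · rw [div_lt_iff₀ Real.two_pi_pos]
      linarith
    · change Circle.exp (2 * Real.pi * (s / (2 * Real.pi))) = Circle.exp s
      rw [mul_div_cancel₀ _ Real.two_pi_pos.ne']
  obtain ⟨Λ, Y, hΛ, hΛd, hY, hY1, hΛY⟩ := exists_dense_isGδ_prod_full_measure (pascalBernoulli β)
    (T := ℝ) (ι := ℕ ⊕ ℕ)
    (Sum.elim (fun i N θ => {x | pathRotation x θ N ∈ B i})
      (fun i N θ => mostRotationsMem A (i + N) θ))
    (by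
      rintro (i | i) N θ
      · exact measurableSet_setOf_pathRotation_mem (hBo i) N θ
      · exact measurableSet_mostRotationsMem hAo _ θ)
    (by
      rintro (i | i) N θ
      · exact eventually_forall_pathRotation_mem (hBo i) N θ
      · exact eventually_mostRotationsMem_subset hAo _ θ)
    (by
      rintro (i | i)
      · exact Measure.dense_of_ae (ae_ae_exists_pathRotation_mem β hβ0 hβ1 (hBo i) (hBne i))
      · refine dense_setOf_int_div_prime.mono ?_
        rintro _ ⟨p, q, hq, rfl⟩
        exact ae_exists_mem_mostRotationsMem β hβ0 hβ1 hA1 p hq i)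
  refine ⟨(↑) ⁻¹' Λ, Y, hΛ.preimage continuous_subtype_val, hΛd.preimage_subtypeVal_Ico 0 1, hY,
    hY1, fun θ hθ x hx => ⟨?_, ?_⟩⟩
  · rw [hbasis.dense_iff]
    rintro _ ⟨i, rfl⟩ _
    obtain ⟨N, hN⟩ := hΛY θ hθ x hx (Sum.inl i)
    exact ⟨_, hN, N, rfl⟩
  · exact not_circleUniformlyDistributed_of_mostRotationsMem (by norm_num) (by norm_num) hAarc
      fun i => hΛY θ hθ x hx (Sum.inr i)
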